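/- Let $(M,g)$ be a smooth Riemannian manifold of dimension $m$ with Levi-Civita connection $\nabla$. A Kenmotsu structure on $M$ with metric $g$ is a triple $(\varphi,\eta,\xi)$ consisting of a smooth field $\varphi$ of endomorphisms of $TM$, a smooth vector field $\xi$ and its dual 1-form $\eta=g(\xi,\cdot)$ such that, for all vector fields $X,Y$, $$\varphi^2X=-X+\eta(X)\xi,\quad \eta(\xi)=1,\quad \eta\circ\varphi=0,\quad \varphi\xi=0,\quad g(\varphi X,\varphi Y)=g(X,Y)-\eta(X)\eta(Y),$$ $$(\nabla_X\varphi)Y=g(\varphi X,Y)\xi-\eta(Y)\varphi X .$$ A 3-Kenmotsu structure on $M$ consists of three Kenmotsu structures $(\varphi_\alpha,\eta,\xi,g)$, $\alpha=1,2,3$, with the same $\eta$, $\xi$ and $g$, such that $\varphi_k=\varphi_i\circ\varphi_j$ for every even permutation $(i,j,k)$ of $(1,2,3)$. Theorem. Let $M$ be a 3-Kenmotsu manifold (a smooth manifold with a Riemannian metric $g$ and a 3-Kenmotsu structure) of dimension $m\ge 9$. Then $M$ is an Einstein space: there is a constant $c\in\mathbb{R}$ such that $\mathrm{Ric}=c\,g$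 on all of $M$, where $\mathrm{Ric}(X,Y)=\sum_k g(R(E_k,X)Y,E_k)$ for a local orthonormal frame $(E_k)$ and $R(X,Y)Z=\nabla_X\nabla_YZ-\nabla_Y\nabla_XZ-\nabla_{[X,Y]}Z$. -/

import Mathlib

open Bundle
open scoped Manifold ContDiff InnerProductSpace

noncomputable section

set_option linter.unusedSectionVars false

namespace Riem

variable {E : Type*} [NormedAddCommGroup E] [NormedSpace ℝ E] [FiniteDimensional ℝ E]
  [CompleteSpace E]
  {H : Type*} [TopologicalSpace H] {I : ModelWithCorners ℝ E H}
  {M : Type*} [TopologicalSpace M] [ChartedSpace H M] [IsManifold I ∞ M]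
  [RiemannianBundle (fun x : M => TangentSpace I x)]
  [IsContMDiffRiemannianBundle I ∞ E (fun x : M => TangentSpace I x)]

/-- The right-hand side of the Koszul formula for `2 g(∇_X Y, Z)` at `x`. -/
def koszul (Y X Z : Π x : M, TangentSpace I x) (x : M) : ℝ :=
  mvfderiv I (fun y => ⟪Y y, Z y⟫_ℝ) x (X x)
    + mvfderiv I (fun y => ⟪Z y, X y⟫_ℝ) x (Y x)
    - mvfderiv I (fun y => ⟪X y, Y y⟫_ℝ) x (Z x)
    + ⟪VectorField.mlieBracket I X Y x, Z x⟫_ℝ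
    - ⟪VectorField.mlieBracket I Y Z x, X x⟫_ℝ
    + ⟪VectorField.mlieBracket I Z X x, Y x⟫_ℝ

lemma mdiffAt_inner {x : M} {Y Z : Π x : M, TangentSpace I x} (hY : MDiffAt (T% Y) x)
    (hZ : MDiffAt (T% Z) x) : MDiffAt (fun y => ⟪Y y, Z y⟫_ℝ) x :=
  MDifferentiableAt.inner_bundle (F := E) hY hZ

theorem koszul_tensorial_left {x : M} {Y Z : Π x : M, TangentSpace I x}
    (hY : MDiffAt (T% Y) x) (hZ : MDiffAt (T% Z) x) :
    TensorialAt I E (fun X => koszul Y X Z x) x where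
  smul {f X} hf hX := by
    have h1 := mvfderiv_fun_mul hf (mdiffAt_inner hZ hX)
    have h2 := mvfderiv_fun_mul hf (mdiffAt_inner hX hY)
    simp [koszul, inner_smul_left, inner_smul_right, inner_add_left,
      VectorField.mlieBracket_smul_left hf hX, VectorField.mlieBracket_smul_right hf hX, h1, h2]
    rw [real_inner_comm (X x) (Z x)]
    ring
  add {X X'} hX hX' := by
    have h1 := mvfderiv_fun_add (mdiffAt_inner hZ hX) (mdiffAt_inner hZ hX')
    have h2 := mvfderiv_fun_add (mdiffAt_inner hX hY) (mdiffAt_inner hX' hY)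
    simp [koszul, inner_add_left, inner_add_right,
      VectorField.mlieBracket_add_left hX hX', VectorField.mlieBracket_add_right hX hX', h1, h2]
    ring

theorem koszul_tensorial_right {x : M} {Y X : Π x : M, TangentSpace I x}
    (hY : MDiffAt (T% Y) x) (hX : MDiffAt (T% X) x) :
    TensorialAt I E (fun Z => koszul Y X Z x) x where
  smul {f Z} hf hZ := by
    have h1 := mvfderiv_fun_mul hf (mdiffAt_inner hY hZ)
    have h2 := mvfderiv_fun_mul hf (mdiffAt_inner hZ hX)
    simp [koszul, inner_smul_left, inner_smul_right, inner_add_left,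
      VectorField.mlieBracket_smul_left hf hZ, VectorField.mlieBracket_smul_right hf hZ, h1, h2]
    rw [real_inner_comm (X x) (Z x), real_inner_comm (Y x) (Z x)]
    ring
  add {Z Z'} hZ hZ' := by
    have h1 := mvfderiv_fun_add (mdiffAt_inner hY hZ) (mdiffAt_inner hY hZ')
    have h2 := mvfderiv_fun_add (mdiffAt_inner hZ hX) (mdiffAt_inner hZ' hX)
    simp [koszul, inner_add_left, inner_add_right,
      VectorField.mlieBracket_add_left hZ hZ', VectorField.mlieBracket_add_right hZ hZ', h1, h2]
    ring

/-- The Koszul form `(v, w) ↦ 2 g(∇_v Y, w)` on `T_x M`, for `Y` differentiable at `x`. -/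
def koszulForm {x : M} {Y : Π x : M, TangentSpace I x} (hY : MDiffAt (T% Y) x) :
    TangentSpace I x →L[ℝ] TangentSpace I x →L[ℝ] ℝ :=
  TensorialAt.mkHom₂ (I := I) (F := E) (F' := E) (fun X Z => koszul Y X Z x) x
    (fun _ hZ => koszul_tensorial_left hY hZ) (fun _ hX => koszul_tensorial_right hY hX)

theorem koszulForm_apply {x : M} {X Y Z : Π x : M, TangentSpace I x} (hX : MDiffAt (T% X) x)
    (hY : MDiffAt (T% Y) x) (hZ : MDiffAt (T% Z) x) :
    koszulForm hY (X x) (Z x) = koszul Y X Z x :=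
  TensorialAt.mkHom₂_apply _ _ hX hZ

/-- The vector `u ∈ T_x M` representing half of a functional: `2 g(u, w) = L w` for all `w`. -/
def halfRiesz (x : M) : (TangentSpace I x →L[ℝ] ℝ) →ₗ[ℝ] TangentSpace I x :=
  haveI : FiniteDimensional ℝ (TangentSpace I x) := inferInstanceAs (FiniteDimensional ℝ E)
  haveI : CompleteSpace (TangentSpace I x) := FiniteDimensional.complete ℝ _
  { toFun := fun L => (2⁻¹ : ℝ) • (InnerProductSpace.toDual ℝ (TangentSpace I x)).symm L
    map_add' := fun L L' => by simp
    map_smul' := fun c L => by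
      rw [map_smulₛₗ, smul_comm]
      rfl }

theorem inner_halfRiesz (x : M) (L : TangentSpace I x →L[ℝ] ℝ) (w : TangentSpace I x) :
    ⟪halfRiesz x L, w⟫_ℝ = 2⁻¹ * L w := by
  have : FiniteDimensional ℝ (TangentSpace I x) := inferInstanceAs (FiniteDimensional ℝ E)
  have : CompleteSpace (TangentSpace I x) := FiniteDimensional.complete ℝ _
  simp [halfRiesz, inner_smul_left]

open scoped Classical in
/-- `v ↦ ∇_v Y` at `x`, determined by the Koszul formula (junk value `0` if the vector field `Y` is
not differentiable at `x`). -/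
def leviCivitaFun (Y : Π x : M, TangentSpace I x) (x : M) :
    TangentSpace I x →L[ℝ] TangentSpace I x :=
  haveI : FiniteDimensional ℝ (TangentSpace I x) := inferInstanceAs (FiniteDimensional ℝ E)
  if hY : MDiffAt (T% Y) x then
    LinearMap.toContinuousLinearMap (halfRiesz x ∘ₗ
      (ContinuousLinearMap.toLinearMap (koszulForm hY)))
  else 0

theorem inner_leviCivitaFun {x : M} {X Y Z : Π x : M, TangentSpace I x} (hX : MDiffAt (T% X) x)
    (hY : MDiffAt (T% Y) x) (hZ : MDiffAt (T% Z) x) :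
    ⟪leviCivitaFun Y x (X x), Z x⟫_ℝ = 2⁻¹ * koszul Y X Z x := by
  rw [← koszulForm_apply hX hY hZ]
  simp [leviCivitaFun, hY, inner_halfRiesz]

theorem ext_of_inner {x : M} {u u' : TangentSpace I x}
    (h : ∀ Z : Π x : M, TangentSpace I x, MDiffAt (T% Z) x → ⟪u, Z x⟫_ℝ = ⟪u', Z x⟫_ℝ) :
    u = u' := by
  refine ext_inner_right ℝ fun w => ?_
  simpa using h (FiberBundle.extend E w) (FiberBundle.mdifferentiableAt_extend ..)

variable (I M) in
/-- The Levi-Civita connection of the Riemannian manifold `M`. -/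
def leviCivita : CovariantDerivative I E (fun x : M => TangentSpace I x) where
  toFun := leviCivitaFun
  isCovariantDerivativeOnUniv :=
    { add := by
        intro Y Y' x hY hY' _
        ext v
        obtain ⟨X, hX, rfl⟩ : ∃ X : Π x : M, TangentSpace I x, MDiffAt (T% X) x ∧ X x = v :=
          ⟨FiberBundle.extend E v, FiberBundle.mdifferentiableAt_extend .., by simp⟩
        refine ext_of_inner fun Z hZ => ?_
        have h1 := mvfderiv_fun_add (mdiffAt_inner hY hZ) (mdiffAt_inner hY' hZ)
        have h2 := mvfderiv_fun_add (mdiffAt_inner hX hY) (mdiffAt_inner hX hY')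
        rw [add_apply, inner_add_left,
          inner_leviCivitaFun hX (mdifferentiableAt_add_section hY hY') hZ,
          inner_leviCivitaFun hX hY hZ, inner_leviCivitaFun hX hY' hZ]
        simp [koszul, inner_add_left, inner_add_right,
          VectorField.mlieBracket_add_left hY hY', VectorField.mlieBracket_add_right hY hY', h1, h2]
        ring
      leibniz := by
        intro Y f x hY hf _
        ext v
        obtain ⟨X, hX, rfl⟩ : ∃ X : Π x : M, TangentSpace I x, MDiffAt (T% X) x ∧ X x = v :=
          ⟨FiberBundle.extend E v, FiberBundle.mdifferentiableAt_extend .., by simp⟩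
        refine ext_of_inner fun Z hZ => ?_
        have h1 := mvfderiv_fun_mul hf (mdiffAt_inner hY hZ)
        have h2 := mvfderiv_fun_mul hf (mdiffAt_inner hX hY)
        rw [add_apply, inner_add_left, smul_apply,
          inner_smul_left, inner_leviCivitaFun hX (hf.smul_section hY) hZ,
          inner_leviCivitaFun hX hY hZ]
        simp [koszul, inner_smul_left, inner_smul_right, inner_add_left,
          VectorField.mlieBracket_smul_left hf hY, VectorField.mlieBracket_smul_right hf hY, h1, h2]
        rw [real_inner_comm (Y x) (X x)]
        ring }

theorem leviCivita_torsion_eq_zero : (leviCivita I M).torsion = 0 := by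
  refine (leviCivita I M).torsion_eq_zero_iff.2 fun {X Y x} hX hY => ?_
  refine ext_of_inner fun Z hZ => ?_
  rw [inner_sub_left]
  erw [inner_leviCivitaFun hX hY hZ, inner_leviCivitaFun hY hX hZ]
  simp only [koszul]
  have e1 : (fun y => ⟪Y y, Z y⟫_ℝ) = fun y => ⟪Z y, Y y⟫_ℝ := by
    ext y; exact real_inner_comm _ _
  have e2 : (fun y => ⟪Z y, X y⟫_ℝ) = fun y => ⟪X y, Z y⟫_ℝ := by
    ext y; exact real_inner_comm _ _
  have e3 : (fun y => ⟪X y, Y y⟫_ℝ) = fun y => ⟪Y y, X y⟫_ℝ := by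
    ext y; exact real_inner_comm _ _
  rw [e1, e2, e3, VectorField.mlieBracket_swap_apply (V := Y) (W := X),
    VectorField.mlieBracket_swap_apply (V := X) (W := Z),
    VectorField.mlieBracket_swap_apply (V := Z) (W := Y)]
  simp only [inner_neg_left]
  ring

theorem leviCivita_metric {x : M} {X Y Z : Π x : M, TangentSpace I x} (hX : MDiffAt (T% X) x)
    (hY : MDiffAt (T% Y) x) (hZ : MDiffAt (T% Z) x) :
    mvfderiv I (fun y => ⟪Y y, Z y⟫_ℝ) x (X x)
      = ⟪leviCivita I M Y x (X x), Z x⟫_ℝ + ⟪Y x, leviCivita I M Z x (X x)⟫_ℝ := by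
  rw [real_inner_comm _ (Y x)]
  erw [inner_leviCivitaFun hX hY hZ, inner_leviCivitaFun hX hZ hY]
  simp only [koszul]
  have e1 : (fun y => ⟪Y y, Z y⟫_ℝ) = fun y => ⟪Z y, Y y⟫_ℝ := by
    ext y; exact real_inner_comm _ _
  have e2 : (fun y => ⟪Z y, X y⟫_ℝ) = fun y => ⟪X y, Z y⟫_ℝ := by
    ext y; exact real_inner_comm _ _
  have e3 : (fun y => ⟪X y, Y y⟫_ℝ) = fun y => ⟪Y y, X y⟫_ℝ := by
    ext y; exact real_inner_comm _ _
  rw [e1, e2, e3, VectorField.mlieBracket_swap_apply (V := Y) (W := X),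
    VectorField.mlieBracket_swap_apply (V := X) (W := Z),
    VectorField.mlieBracket_swap_apply (V := Z) (W := Y)]
  simp only [inner_neg_left]
  ring

/-- The curvature `R(X, Y)Z = ∇_X ∇_Y Z - ∇_Y ∇_X Z - ∇_[X, Y] Z`. -/
def curvature (X Y Z : Π x : M, TangentSpace I x) (x : M) : TangentSpace I x :=
  leviCivita I M (fun y => leviCivita I M Z y (Y y)) x (X x)
    - leviCivita I M (fun y => leviCivita I M Z y (X y)) x (Y x)
    - leviCivita I M Z x (VectorField.mlieBracket I X Y x)

/-- The Ricci tensor `Ric(v, w) = ∑ₖ g(R(eₖ, v)w, eₖ)` at `x`, for an orthonormal basis `e` of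
`T_x M`. Tangent vectors at `x` are extended to vector fields that are smooth near `x`; the
curvature at `x` does not depend on the extension. -/
def ricci (x : M) (v w : TangentSpace I x) : ℝ :=
  haveI : FiniteDimensional ℝ (TangentSpace I x) := inferInstanceAs (FiniteDimensional ℝ E)
  ∑ k, ⟪curvature (FiberBundle.extend E (stdOrthonormalBasis ℝ (TangentSpace I x) k))
      (FiberBundle.extend E v) (FiberBundle.extend E w) x,
    stdOrthonormalBasis ℝ (TangentSpace I x) k⟫_ℝ

variable (I M) in
/-- `M` is an Einstein space: the Ricci tensor is a constant multiple of the metric. -/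
def IsEinstein : Prop :=
  ∃ c : ℝ, ∀ (x : M) (v w : TangentSpace I x), ricci x v w = c * ⟪v, w⟫_ℝ

/-- `(φ, η, ξ, g)` is an almost contact metric structure, where `g` is the Riemannian metric of `M`.
The 1-form `η` is smooth because it is the dual of the smooth vector field `ξ`. -/
structure IsAlmostContactMetric (φ : Π x : M, TangentSpace I x →L[ℝ] TangentSpace I x)
    (η : Π x : M, TangentSpace I x →L[ℝ] ℝ) (ξ : Π x : M, TangentSpace I x) : Prop where
  contMDiff_phi : ContMDiff I (I.prod 𝓘(ℝ, E →L[ℝ] E)) ∞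
    (fun x => TotalSpace.mk' (E →L[ℝ] E)
      (E := fun x : M => TangentSpace I x →L[ℝ] TangentSpace I x) x (φ x))
  contMDiff_xi : ContMDiff I (I.prod 𝓘(ℝ, E)) ∞
    (fun x => TotalSpace.mk' E (E := fun x : M => TangentSpace I x) x (ξ x))
  eta_eq : ∀ (x : M) (v : TangentSpace I x), η x v = ⟪ξ x, v⟫_ℝ
  phi_phi : ∀ (x : M) (v : TangentSpace I x), φ x (φ x v) = -v + η x v • ξ x
  eta_xi : ∀ x : M, η x (ξ x) = 1
  eta_phi : ∀ (x : M) (v : TangentSpace I x), η x (φ x v) = 0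
  phi_xi : ∀ x : M, φ x (ξ x) = 0
  inner_phi_phi : ∀ (x : M) (v w : TangentSpace I x),
    ⟪φ x v, φ x w⟫_ℝ = ⟪v, w⟫_ℝ - η x v * η x w

/-- The covariant derivative `(∇_v φ)Y = ∇_v (φ Y) - φ (∇_v Y)` at `x`. -/
def covDerivEnd (φ : Π x : M, TangentSpace I x →L[ℝ] TangentSpace I x)
    (Y : Π x : M, TangentSpace I x) (x : M) (v : TangentSpace I x) : TangentSpace I x :=
  leviCivita I M (fun y => φ y (Y y)) x v - φ x (leviCivita I M Y x v)

/-- `(φ, η, ξ, g)` is a Kenmotsu structure: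
`(∇_X φ)Y = g(φ X, Y) ξ - η(Y) φ X` for all vector fields `X`, `Y`. -/
structure IsKenmotsu (φ : Π x : M, TangentSpace I x →L[ℝ] TangentSpace I x)
    (η : Π x : M, TangentSpace I x →L[ℝ] ℝ) (ξ : Π x : M, TangentSpace I x) : Prop
    extends IsAlmostContactMetric φ η ξ where
  covDerivEnd_eq : ∀ (X Y : Π x : M, TangentSpace I x) (x : M),
    MDiffAt (T% X) x → MDiffAt (T% Y) x →
    covDerivEnd φ Y x (X x) = ⟪φ x (X x), Y x⟫_ℝ • ξ x - η x (Y x) • φ x (X x)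

/-- A 3-Kenmotsu structure: three Kenmotsu structures `(φ₁, η, ξ, g)`, `(φ₂, η, ξ, g)`,
`(φ₃, η, ξ, g)` with `φₖ = φᵢ ∘ φⱼ` for the even permutations `(i, j, k) = (i, i + 1, i + 2)` of the
three indices (taken modulo 3). -/
structure IsThreeKenmotsu (φ : Fin 3 → Π x : M, TangentSpace I x →L[ℝ] TangentSpace I x)
    (η : Π x : M, TangentSpace I x →L[ℝ] ℝ) (ξ : Π x : M, TangentSpace I x) : Prop where
  isKenmotsu : ∀ i, IsKenmotsu (φ i) η ξ
  phi_comp : ∀ (i : Fin 3) (x : M) (v : TangentSpace I x),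
    φ (i + 2) x v = φ i x (φ (i + 1) x v)

end Riem
end

/-!
A Kenmotsu metric is locally a warped product `dt² + e^{2t} g_K` with `g_K` Kähler, and its
curvature tensor `R` is that of hyperbolic space up to a Kähler-type part. The proof works with
that part directly, without constructing the warped product: with
`P(X, Y)Z = R(X, Y)Z + g(Y, Z) X - g(X, Z) Y`, the Kenmotsu equation, differentiated once more,
shows that `P(X, Y)` commutes with `φ` (`Riem.IsKenmotsu.curvature_phi`), and
`P(X, Y) ξ = 0` follows (`Riem.IsKenmotsu.curvatureAt_xi`).

The rest is linear algebra in one tangent space. For a tensor with the symmetries of a Riemann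
tensor that commutes with a skew `φ`, the first Bianchi identity gives
`2 Ric_P(v, φ w) = -tr (φ ∘ P(v, w))`
(`Riem.IsCurvatureLike.two_mul_trace_ricciOperator`). If `P(v, w)` commutes with a whole
quaternionic triple, then `φ₂ = φ₀ φ₁ = -φ₁ φ₀` forces the trace on the right to vanish by cyclicity, as for
hyperkähler metrics, so that `P` is Ricci-flat
(`Riem.IsCurvatureLike.trace_ricciOperator_eq_zero`). Hence `Ric = -(dim M - 1) g`.

The symmetries of `R` are proved for smooth vector fields. They need the smoothness of `∇_X Y`
(`Riem.contMDiffAt_leviCivita`), and `[X, Y] f = X (Y f) - Y (X f)`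
(`Riem.mvfderiv_mlieBracket`), which is extracted from the Jacobi identity. Skew-symmetry of
`R(X, Y)` also yields its tensoriality: `g(R(X, Y)Z, W) = -g(R(X, Y)W, Z)` involves `Z` only
through its value at the point (`Riem.curvature_extend`).
-/

namespace Riem

set_option linter.unusedSectionVars false

/-! ### Algebraic curvature tensors -/

section CurvatureLike

variable {V : Type*} [NormedAddCommGroup V] [InnerProductSpace ℝ V]

/-- `R u v w` has the algebraic symmetries of the Riemann tensor `R(u, v)w`: it is antisymmetric
in `u` and `v`, skew-adjoint in `w`, and satisfies the first Bianchi identity. Linearity in each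
variable is a consequence, see `isLinearMap_right` and `isLinearMap_left`. -/
structure IsCurvatureLike (R : V → V → V → V) : Prop where
  swap : ∀ u v w, R v u w = -R u v w
  skew : ∀ u v w z, ⟪R u v z, w⟫_ℝ = -⟪R u v w, z⟫_ℝ
  bianchi : ∀ u v w, R u v w + R v w u + R w u v = 0

namespace IsCurvatureLike

variable {R : V → V → V → V}

theorem isLinearMap_right (hR : IsCurvatureLike R) (u v : V) : IsLinearMap ℝ (R u v) where
  map_add w w' := ext_inner_right ℝ fun z => by
    rw [hR.skew, inner_add_left, hR.skew u v z w, hR.skew u v z w', inner_add_right]; ring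
  map_smul c w := ext_inner_right ℝ fun z => by
    rw [hR.skew, inner_smul_left, hR.skew u v z w, inner_smul_right]; simp

theorem pair_symm (hR : IsCurvatureLike R) (u v w z : V) :
    ⟪R u v w, z⟫_ℝ = ⟪R w z u, v⟫_ℝ := by
  have b (a b c d : V) : ⟪R a b c, d⟫_ℝ + ⟪R b c a, d⟫_ℝ + ⟪R c a b, d⟫_ℝ = 0 := by
    rw [← inner_add_left, ← inner_add_left, hR.bianchi, inner_zero_left]
  have s (a b c d : V) : ⟪R b a c, d⟫_ℝ = -⟪R a b c, d⟫_ℝ := by rw [hR.swap, inner_neg_left]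
  have k := hR.skew
  -- the four Bianchi identities with the last slot running through `z`, `u`, `v`, `w`
  linarith [b u v w z, b v w z u, b w z u v, b z u v w, s u z v w, s z w v u, k u v w z,
    k v w z u, k w z u v, k z u v w, k u w z v, k v z u w, s u w v z, s v z w u, k w u v z,
    k z v w u, s v z u w, s u w z v, k v w u z, k z u w v, k u z v w, k z w u v, s w z u v]

theorem isLinearMap_left (hR : IsCurvatureLike R) (v w : V) :
    IsLinearMap ℝ (fun u => R u v w) where
  map_add u u' := ext_inner_right ℝ fun z => by
    rw [inner_add_left]
    simp only [hR.pair_symm _ v w z, (hR.isLinearMap_right w z).map_add, inner_add_left]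
  map_smul c u := ext_inner_right ℝ fun z => by
    rw [inner_smul_left]
    simp only [hR.pair_symm _ v w z, (hR.isLinearMap_right w z).map_smul, inner_smul_left]

/-- The curvature operator `w ↦ R(u, v)w`. -/
noncomputable def operator (hR : IsCurvatureLike R) (u v : V) : V →ₗ[ℝ] V :=
  (hR.isLinearMap_right u v).mk'

/-- The endomorphism `u ↦ R(u, v)w`, whose trace is the Ricci tensor at `(v, w)`. -/
noncomputable def ricciOperator (hR : IsCurvatureLike R) (v w : V) : V →ₗ[ℝ] V :=
  (hR.isLinearMap_left v w).mk'

theorem operator_apply (hR : IsCurvatureLike R) (u v w : V) : hR.operator u v w = R u v w := rfl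

theorem ricciOperator_apply (hR : IsCurvatureLike R) (u v w : V) :
    hR.ricciOperator v w u = R u v w := rfl

/-- Subtracting the curvature tensor of constant curvature `-1` preserves the symmetries. -/
theorem add_constCurv (hR : IsCurvatureLike R) :
    IsCurvatureLike fun u v w => R u v w + (⟪v, w⟫_ℝ • u - ⟪u, w⟫_ℝ • v) where
  swap u v w := by rw [hR.swap]; module
  skew u v w z := by
    rw [inner_add_left, inner_add_left, hR.skew]
    simp only [inner_sub_left, inner_smul_left, RCLike.conj_to_real]
    ring
  bianchi u v w := by
    have := hR.bianchi u v w
    rw [real_inner_comm u w, real_inner_comm w v, real_inner_comm v u, ← this]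
    module

section Ricci

variable [FiniteDimensional ℝ V]

/-- The Kähler-type identity behind Ricci-flatness of hyperkähler metrics: if the skew
endomorphism `φ` commutes with all curvature operators, then the Bianchi identity expresses
`2 Ric(v, φ w)` as `-tr (φ ∘ R(v, w))`. -/
theorem two_mul_trace_ricciOperator (hR : IsCurvatureLike R) {φ : V →ₗ[ℝ] V}
    (hskew : ∀ u v, ⟪φ u, v⟫_ℝ = -⟪u, φ v⟫_ℝ) (hcomm : ∀ u v w, R u v (φ w) = φ (R u v w))
    (v w : V) :
    2 * LinearMap.trace ℝ V (hR.ricciOperator v (φ w)) =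
      -LinearMap.trace ℝ V (φ ∘ₗ hR.operator v w) := by
  have h1 : hR.ricciOperator v (φ w) = φ ∘ₗ hR.ricciOperator v w := by
    ext a
    simp [ricciOperator_apply, hcomm]
  have h2 : hR.ricciOperator v w = hR.ricciOperator w v - hR.operator v w := by
    ext a
    have := hR.bianchi a v w
    rw [hR.swap a w v] at this
    simp only [LinearMap.sub_apply, ricciOperator_apply, operator_apply]
    rw [eq_sub_iff_add_eq, ← sub_eq_zero, ← this]
    abel
  -- `φ ∘ (a ↦ R(a, w)v)` is minus the adjoint of `(a ↦ R(a, v)w) ∘ φ`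
  have h3 : LinearMap.trace ℝ V (φ ∘ₗ hR.ricciOperator w v) =
      -LinearMap.trace ℝ V (hR.ricciOperator v w ∘ₗ φ) := by
    let b := stdOrthonormalBasis ℝ V
    rw [LinearMap.trace_eq_sum_inner _ b, LinearMap.trace_eq_sum_inner _ b,
      ← Finset.sum_neg_distrib]
    refine Finset.sum_congr rfl fun i _ => ?_
    simp only [LinearMap.comp_apply, ricciOperator_apply]
    rw [real_inner_comm, hskew, hR.pair_symm, hR.swap, inner_neg_left, hR.skew,
      real_inner_comm (b i)]
    ring
  have h4 := LinearMap.trace_comp_comm' φ (hR.ricciOperator v w)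
  have h5 := congr(LinearMap.trace ℝ V (φ ∘ₗ $h2))
  rw [LinearMap.comp_sub, map_sub, h3, h4] at h5
  rw [h1]
  linarith

/-- A curvature-like tensor that annihilates `ξ` and commutes with a quaternionic triple acting
on `ξᗮ` is Ricci-flat. Here `A`, `B`, `C = A ∘ B` is the triple, and `B ∘ A = -C`. -/
theorem trace_ricciOperator_eq_zero (hR : IsCurvatureLike R) {A B C : V →ₗ[ℝ] V} {ξ : V}
    (hAB : ∀ v, C v = A (B v)) (hBA : ∀ v, B (A v) = -C v)
    (hC : ∀ v, C (C v) = -v + ⟪ξ, v⟫_ℝ • ξ) (hCskew : ∀ u v, ⟪C u, v⟫_ℝ = -⟪u, C v⟫_ℝ)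
    (hA : ∀ u v w, R u v (A w) = A (R u v w)) (hB : ∀ u v w, R u v (B w) = B (R u v w))
    (hξ : ∀ u v, R u v ξ = 0) (v w : V) :
    LinearMap.trace ℝ V (hR.ricciOperator v w) = 0 := by
  have hcomm : ∀ u v w, R u v (C w) = C (R u v w) := fun u v w => by
    rw [hAB, hAB, hA, hB]
  have htr (u v : V) : LinearMap.trace ℝ V (C ∘ₗ hR.operator u v) = 0 := by
    -- `tr (A B R) = tr (B R A) = tr (B A R) = -tr (A B R)`
    have h1 : C ∘ₗ hR.operator u v = A ∘ₗ (B ∘ₗ hR.operator u v) := by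
      ext w; simp [hAB]
    have h2 : (B ∘ₗ hR.operator u v) ∘ₗ A = -(C ∘ₗ hR.operator u v) := by
      ext w
      simp [operator_apply, hA, hBA]
    have h3 := LinearMap.trace_comp_comm' (B ∘ₗ hR.operator u v) A
    rw [h2, ← h1, map_neg] at h3
    linarith
  have h1 (w : V) : LinearMap.trace ℝ V (hR.ricciOperator v (C w)) = 0 := by
    have := hR.two_mul_trace_ricciOperator hCskew hcomm v w
    rw [htr] at this
    linarith
  have h2 : hR.ricciOperator v w = -hR.ricciOperator v (C (C w)) := by
    ext a
    rw [LinearMap.neg_apply, ricciOperator_apply, ricciOperator_apply, hC,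
      (hR.isLinearMap_right a v).map_add, (hR.isLinearMap_right a v).map_neg,
      (hR.isLinearMap_right a v).map_smul, hξ]
    simp
  rw [h2, map_neg, h1, neg_zero]

end Ricci

/-- If `R` differs from the curvature tensor of constant curvature `-1` by a Ricci-flat tensor,
then its Ricci tensor is `-(dim V - 1)` times the inner product. -/
theorem sum_inner_eq (hR : IsCurvatureLike R) {ι : Type*} [Fintype ι]
    (b : OrthonormalBasis ι ℝ V) (v w : V)
    (h : LinearMap.trace ℝ V (hR.add_constCurv.ricciOperator v w) = 0) :
    ∑ k, ⟪R (b k) v w, b k⟫_ℝ = -((Module.finrank ℝ V : ℝ) - 1) * ⟪v, w⟫_ℝ := by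
  rw [LinearMap.trace_eq_sum_inner _ b] at h
  simp only [ricciOperator_apply, inner_add_right, inner_sub_right, inner_smul_right,
    Finset.sum_add_distrib, Finset.sum_sub_distrib] at h
  have h1 : ∑ k, ⟪b k, w⟫_ℝ * ⟪b k, v⟫_ℝ = ⟪v, w⟫_ℝ := by
    rw [← b.sum_inner_mul_inner v w]
    exact Finset.sum_congr rfl fun k _ => by rw [real_inner_comm v (b k)]; ring
  have h2 : ∑ k, ⟪v, w⟫_ℝ * ⟪b k, b k⟫_ℝ = Module.finrank ℝ V * ⟪v, w⟫_ℝ := by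
    simp [b.norm_eq_one, Module.finrank_eq_card_basis b.toBasis]
  rw [h1, h2] at h
  simp only [real_inner_comm] at h ⊢
  linarith


end IsCurvatureLike

end CurvatureLike

variable {E : Type*} [NormedAddCommGroup E] [NormedSpace ℝ E] [FiniteDimensional ℝ E]
  [CompleteSpace E]
  {H : Type*} [TopologicalSpace H] {I : ModelWithCorners ℝ E H}
  {M : Type*} [TopologicalSpace M] [ChartedSpace H M] [IsManifold I ∞ M]
  [RiemannianBundle (fun x : M => TangentSpace I x)]
  [IsContMDiffRiemannianBundle I ∞ E (fun x : M => TangentSpace I x)]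

/-! ### Smoothness of the Levi-Civita connection -/

theorem contMDiffAt_det {ι : Type*} [Fintype ι] [DecidableEq ι] {x : M} {A : M → Matrix ι ι ℝ}
    (hA : ∀ i j, CMDiffAt ∞ (fun y => A y i j) x) : CMDiffAt ∞ (fun y => (A y).det) x := by
  simp only [Matrix.det_apply']
  exact contMDiffAt_finsetSum fun σ _ =>
    contMDiffAt_const.mul (contMDiffAt_finsetProd fun i _ => hA _ _)

theorem contMDiffAt_inner {x : M} {Y Z : Π x : M, TangentSpace I x} (hY : CMDiffAt ∞ (T% Y) x)
    (hZ : CMDiffAt ∞ (T% Z) x) : CMDiffAt ∞ (fun y => ⟪Y y, Z y⟫_ℝ) x :=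
  ContMDiffAt.inner_bundle (F := E) hY hZ

/-- Coefficients in a local frame are obtained from inner products with the frame by Cramer's
rule for the Gram matrix. -/
theorem contMDiffAt_of_inner {x : M} {V : Π x : M, TangentSpace I x}
    (h : ∀ W : Π x : M, TangentSpace I x, CMDiffAt ∞ (T% W) x →
      CMDiffAt ∞ (fun y => ⟪W y, V y⟫_ℝ) x) : CMDiffAt ∞ (T% V) x := by
  let e := trivializationAt E (fun x : M => TangentSpace I x) x
  let b := Module.finBasis ℝ E
  have hx : x ∈ e.baseSet := FiberBundle.mem_baseSet_trivializationAt' x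
  have hs := e.isLocalFrameOn_localFrame_baseSet I ∞ b
  have hu := e.open_baseSet.mem_nhds hx
  refine hs.contMDiffAt_of_coeff (fun i => ?_) hu
  let s := e.localFrame b
  have hsm (j) : CMDiffAt ∞ (T% (s j)) x := contMDiffAt_localFrame_of_mem ∞ e b j hx
  let G (y : M) : Matrix _ _ ℝ := Matrix.gram ℝ (fun j => s j y)
  have hG : ∀ y ∈ e.baseSet, (G y).det ≠ 0 := fun y hy =>
    Matrix.det_gram_ne_zero_iff_linearIndependent.2 (hs.linearIndependent hy)
  have key : CMDiffAt ∞
      (fun y => ((G y).updateCol i fun j => ⟪s j y, V y⟫_ℝ).det / (G y).det) x := by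
    refine ContMDiffAt.div₀ (contMDiffAt_det fun j k => ?_) (contMDiffAt_det fun j k => ?_)
      (hG x hx)
    · by_cases hk : k = i
      · simpa [Matrix.updateCol_apply, hk] using h _ (hsm j)
      · simpa [Matrix.updateCol_apply, hk, G, Matrix.gram_apply] using
          contMDiffAt_inner (hsm j) (hsm k)
    · exact contMDiffAt_inner (hsm j) (hsm k)
  refine key.congr_of_eventuallyEq ?_
  filter_upwards [hu] with y hy
  have h1 : (fun j => ⟪s j y, V y⟫_ℝ) = (G y).mulVec (fun k => hs.coeff k y (V y)) := by
    ext j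
    conv_lhs => rw [hs.coeff_sum_eq V hy, inner_sum]
    simp [Matrix.mulVec, dotProduct, G, Matrix.gram_apply, inner_smul_right, mul_comm, s]
  rw [eq_div_iff (hG y hy), ← Matrix.cramer_apply, h1, Matrix.cramer_eq_adjugate_mulVec,
    Matrix.mulVec_mulVec, Matrix.adjugate_mul]
  simp [Matrix.smul_mulVec, mul_comm]

theorem contMDiffAt_mlieBracket {x : M} {X Y : Π x : M, TangentSpace I x}
    (hX : CMDiffAt ∞ (T% X) x) (hY : CMDiffAt ∞ (T% Y) x) :
    CMDiffAt ∞ (T% (VectorField.mlieBracket I X Y)) x := by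
  have : IsManifold I (((⊤ : ℕ∞) : ℕ∞ω) + 1) M := inferInstanceAs (IsManifold I ∞ M)
  have : IsManifold I (minSmoothness ℝ 2) M := by
    rw [minSmoothness_of_isRCLikeNormedField]; infer_instance
  refine ContMDiffAt.mlieBracket_vectorField (m := ⊤) (n := ⊤) hX hY ?_
  simp

theorem mdiffAt_of_contMDiffAt {x : M} {X : Π x : M, TangentSpace I x}
    (hX : CMDiffAt ∞ (T% X) x) : MDiffAt (T% X) x :=
  hX.mdifferentiableAt (by simp)

theorem eventually_mdiffAt {x : M} {X : Π x : M, TangentSpace I x}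
    (hX : CMDiffAt ∞ (T% X) x) : ∀ᶠ y in nhds x, MDiffAt (T% X) y := by
  have h1 : CMDiffAt 1 (T% X) x := hX.of_le (by simp)
  filter_upwards [(contMDiffAt_iff_contMDiffAt_nhds (by simp)).1 h1] with y hy
  exact hy.mdifferentiableAt (by simp)

theorem eventually_mdiffAt_fun {x : M} {f : M → ℝ}
    (hf : CMDiffAt ∞ f x) : ∀ᶠ y in nhds x, MDiffAt f y := by
  have h1 : CMDiffAt 1 f x := hf.of_le (by simp)
  filter_upwards [(contMDiffAt_iff_contMDiffAt_nhds (by simp)).1 h1] with y hy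
  exact hy.mdifferentiableAt (by simp)

/-- The directional derivative `X f` of a smooth function is smooth. It is read off from
`[X, f Z] = (X f) Z + f [X, Z]`, where `Z` is a vector field that does not vanish at the point. -/
theorem contMDiffAt_mvfderiv [Nontrivial E] {x : M} {X : Π x : M, TangentSpace I x} {f : M → ℝ}
    (hX : CMDiffAt ∞ (T% X) x) (hf : CMDiffAt ∞ f x) :
    CMDiffAt ∞ (fun y => mvfderiv I f y (X y)) x := by
  have : Nontrivial (TangentSpace I x) := inferInstanceAs (Nontrivial E)
  obtain ⟨v, hv⟩ := exists_ne (0 : TangentSpace I x)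
  let Z : Π x : M, TangentSpace I x := FiberBundle.extend E v
  have hZ : CMDiffAt ∞ (T% Z) x := FiberBundle.contMDiffAt_extend I E v
  have hZx : Z x = v := by simp [Z]
  have hZ0 : ⟪Z x, Z x⟫_ℝ ≠ 0 := by simpa [hZx] using hv
  have h1 : CMDiffAt ∞ (T% (VectorField.mlieBracket I X (f • Z)
      - f • VectorField.mlieBracket I X Z)) x :=
    (contMDiffAt_mlieBracket hX (hf.smul_section hZ)).sub_section
      (hf.smul_section (contMDiffAt_mlieBracket hX hZ))
  have h2 := (contMDiffAt_inner h1 hZ).div₀ (contMDiffAt_inner hZ hZ) hZ0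
  refine h2.congr_of_eventuallyEq ?_
  filter_upwards [eventually_mdiffAt hZ, eventually_mdiffAt_fun hf,
    (contMDiffAt_inner hZ hZ).continuousAt.eventually_ne hZ0] with y hy hfy hy0
  rw [Pi.div_apply, eq_div_iff hy0, Pi.sub_apply, VectorField.mlieBracket_smul_right hfy hy]
  simp [inner_smul_left]

theorem contMDiffAt_leviCivita [Nontrivial E] {x : M} {X Y : Π x : M, TangentSpace I x}
    (hX : CMDiffAt ∞ (T% X) x) (hY : CMDiffAt ∞ (T% Y) x) :
    CMDiffAt ∞ (T% (fun y => leviCivita I M Y y (X y))) x := by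
  refine contMDiffAt_of_inner fun Z hZ => ?_
  have h : CMDiffAt ∞ (fun y => 2⁻¹ * koszul Y X Z y) x := by
    refine contMDiffAt_const.mul ?_
    unfold koszul
    exact (((((contMDiffAt_mvfderiv hX (contMDiffAt_inner hY hZ)).add
      (contMDiffAt_mvfderiv hY (contMDiffAt_inner hZ hX))).sub
      (contMDiffAt_mvfderiv hZ (contMDiffAt_inner hX hY))).add
      (contMDiffAt_inner (contMDiffAt_mlieBracket hX hY) hZ)).sub
      (contMDiffAt_inner (contMDiffAt_mlieBracket hY hZ) hX)).add
      (contMDiffAt_inner (contMDiffAt_mlieBracket hZ hX) hY)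
  refine h.congr_of_eventuallyEq ?_
  filter_upwards [eventually_mdiffAt hX, eventually_mdiffAt hY, eventually_mdiffAt hZ]
    with y hXy hYy hZy
  rw [← inner_leviCivitaFun hXy hYy hZy, real_inner_comm]
  rfl

/-! ### Symmetries of the curvature tensor -/

theorem jacobi_mlieBracket {x : M} {X Y Z : Π x : M, TangentSpace I x}
    (hX : CMDiffAt ∞ (T% X) x) (hY : CMDiffAt ∞ (T% Y) x) (hZ : CMDiffAt ∞ (T% Z) x) :
    VectorField.mlieBracket I X (VectorField.mlieBracket I Y Z) x =
      VectorField.mlieBracket I (VectorField.mlieBracket I X Y) Z x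
        + VectorField.mlieBracket I Y (VectorField.mlieBracket I X Z) x := by
  have : IsManifold I (minSmoothness ℝ 3) M := by
    rw [minSmoothness_of_isRCLikeNormedField]; infer_instance
  have h : minSmoothness ℝ 2 ≤ ∞ := by
    rw [minSmoothness_of_isRCLikeNormedField]; exact ENat.LEInfty.out
  exact VectorField.leibniz_identity_mlieBracket_apply (hX.of_le h) (hY.of_le h) (hZ.of_le h)

theorem mvfderiv_congr {x : M} {f g : M → ℝ} (h : f =ᶠ[nhds x] g) :
    mvfderiv I f x = mvfderiv I g x := by
  ext v
  simp only [mvfderiv]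
  rw [h.mfderiv_eq]
  rfl

/-- The Lie bracket acts on smooth functions as the commutator of derivations: compare the
coefficients of `Z` in the Jacobi identity for `X`, `Y` and `f Z`. -/
theorem mvfderiv_mlieBracket [Nontrivial E] {x : M} {X Y : Π x : M, TangentSpace I x} {f : M → ℝ}
    (hX : CMDiffAt ∞ (T% X) x) (hY : CMDiffAt ∞ (T% Y) x) (hf : CMDiffAt ∞ f x) :
    mvfderiv I f x (VectorField.mlieBracket I X Y x) =
      mvfderiv I (fun y => mvfderiv I f y (Y y)) x (X x)
        - mvfderiv I (fun y => mvfderiv I f y (X y)) x (Y x) := by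
  have : Nontrivial (TangentSpace I x) := inferInstanceAs (Nontrivial E)
  obtain ⟨v, hv⟩ := exists_ne (0 : TangentSpace I x)
  let Z : Π x : M, TangentSpace I x := FiberBundle.extend E v
  have hZ : CMDiffAt ∞ (T% Z) x := FiberBundle.contMDiffAt_extend I E v
  have hZx : Z x = v := by simp [Z]
  have hfx : MDiffAt f x := (eventually_mdiffAt_fun hf).self_of_nhds
  have key (X Y : Π x : M, TangentSpace I x) (hX : CMDiffAt ∞ (T% X) x)
      (hY : CMDiffAt ∞ (T% Y) x) :
      VectorField.mlieBracket I X (VectorField.mlieBracket I Y (f • Z)) x =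
        mvfderiv I (fun y => mvfderiv I f y (Y y)) x (X x) • Z x
          + mvfderiv I f x (Y x) • VectorField.mlieBracket I X Z x
          + (mvfderiv I f x (X x) • VectorField.mlieBracket I Y Z x
          + f x • VectorField.mlieBracket I X (VectorField.mlieBracket I Y Z) x) := by
    have h1 : VectorField.mlieBracket I Y (f • Z) =ᶠ[nhds x]
        (fun y => mvfderiv I f y (Y y)) • Z + f • VectorField.mlieBracket I Y Z := by
      filter_upwards [eventually_mdiffAt hZ, eventually_mdiffAt_fun hf] with y hy hfy
      exact VectorField.mlieBracket_smul_right hfy hy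
    have h2 := contMDiffAt_mvfderiv hY hf
    have h3 := contMDiffAt_mlieBracket hY hZ
    rw [Filter.EventuallyEq.rfl.mlieBracket_vectorField_eq h1,
      VectorField.mlieBracket_add_right (mdiffAt_of_contMDiffAt (h2.smul_section hZ))
        (mdiffAt_of_contMDiffAt (hf.smul_section h3)),
      VectorField.mlieBracket_smul_right (eventually_mdiffAt_fun h2).self_of_nhds
        (mdiffAt_of_contMDiffAt hZ),
      VectorField.mlieBracket_smul_right hfx (mdiffAt_of_contMDiffAt h3)]
  have h := jacobi_mlieBracket hX hY (hf.smul_section hZ)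
  rw [key X Y hX hY, key Y X hY hX,
    VectorField.mlieBracket_smul_right hfx (mdiffAt_of_contMDiffAt hZ),
    jacobi_mlieBracket hX hY hZ, hZx] at h
  refine smul_left_injective ℝ hv ?_
  simp only
  rw [sub_smul, eq_sub_iff_add_eq]
  rw [← sub_eq_zero] at h ⊢
  rw [← neg_eq_zero, ← h]
  module

theorem leviCivita_sub_eq_mlieBracket {x : M} {X Y : Π x : M, TangentSpace I x}
    (hX : MDiffAt (T% X) x) (hY : MDiffAt (T% Y) x) :
    leviCivita I M Y x (X x) - leviCivita I M X x (Y x) = VectorField.mlieBracket I X Y x :=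
  (leviCivita I M).torsion_eq_zero_iff.1 leviCivita_torsion_eq_zero hX hY

theorem leviCivita_congr {x : M} {Y Y' : Π x : M, TangentSpace I x} (hY : MDiffAt (T% Y) x)
    (hY' : MDiffAt (T% Y') x) (h : ∀ᶠ y in nhds x, Y y = Y' y) :
    leviCivita I M Y x = leviCivita I M Y' x :=
  (leviCivita I M).isCovariantDerivativeOnUniv.congr_of_eventuallyEq hY hY' Filter.univ_mem h

theorem leviCivita_add {x : M} {Y Y' : Π x : M, TangentSpace I x} (hY : MDiffAt (T% Y) x)
    (hY' : MDiffAt (T% Y') x) :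
    leviCivita I M (Y + Y') x = leviCivita I M Y x + leviCivita I M Y' x :=
  (leviCivita I M).isCovariantDerivativeOnUniv.add hY hY'

theorem leviCivita_smul {x : M} {Y : Π x : M, TangentSpace I x} {f : M → ℝ}
    (hY : MDiffAt (T% Y) x) (hf : MDiffAt f x) (v : TangentSpace I x) :
    leviCivita I M (f • Y) x v = f x • leviCivita I M Y x v + mvfderiv I f x v • Y x := by
  rw [(leviCivita I M).isCovariantDerivativeOnUniv.leibniz hY hf]
  rfl

theorem leviCivita_sub {x : M} {Y Y' : Π x : M, TangentSpace I x} (hY : MDiffAt (T% Y) x)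
    (hY' : MDiffAt (T% Y') x) :
    leviCivita I M (Y - Y') x = leviCivita I M Y x - leviCivita I M Y' x := by
  rw [eq_sub_iff_add_eq, ← leviCivita_add (mdifferentiableAt_sub_section hY hY') hY',
    sub_add_cancel]

theorem curvature_swap (X Y Z : Π x : M, TangentSpace I x) (x : M) :
    curvature Y X Z x = -curvature X Y Z x := by
  rw [curvature, curvature, VectorField.mlieBracket_swap_apply, map_neg]
  abel

section Smooth

variable [Nontrivial E] {x : M} {X Y Z W : Π x : M, TangentSpace I x}

/-- Second derivative of an inner product of smooth vector fields. -/
theorem mvfderiv_mvfderiv_inner (hX : CMDiffAt ∞ (T% X) x) (hY : CMDiffAt ∞ (T% Y) x)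
    (hZ : CMDiffAt ∞ (T% Z) x) (hW : CMDiffAt ∞ (T% W) x) :
    mvfderiv I (fun y => mvfderiv I (fun y => ⟪Z y, W y⟫_ℝ) y (Y y)) x (X x) =
      ⟪leviCivita I M (fun y => leviCivita I M Z y (Y y)) x (X x), W x⟫_ℝ
        + ⟪leviCivita I M Z x (Y x), leviCivita I M W x (X x)⟫_ℝ
        + (⟪leviCivita I M Z x (X x), leviCivita I M W x (Y x)⟫_ℝ
        + ⟪Z x, leviCivita I M (fun y => leviCivita I M W y (Y y)) x (X x)⟫_ℝ) := by
  have h1 : (fun y => mvfderiv I (fun y => ⟪Z y, W y⟫_ℝ) y (Y y)) =ᶠ[nhds x]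
      fun y => ⟪leviCivita I M Z y (Y y), W y⟫_ℝ + ⟪Z y, leviCivita I M W y (Y y)⟫_ℝ := by
    filter_upwards [eventually_mdiffAt hY, eventually_mdiffAt hZ, eventually_mdiffAt hW]
      with y hy hz hw
    exact leviCivita_metric hy hz hw
  have hx := mdiffAt_of_contMDiffAt hX
  have hz := mdiffAt_of_contMDiffAt hZ
  have hw := mdiffAt_of_contMDiffAt hW
  have hyz := mdiffAt_of_contMDiffAt (contMDiffAt_leviCivita hY hZ)
  have hyw := mdiffAt_of_contMDiffAt (contMDiffAt_leviCivita hY hW)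
  rw [mvfderiv_congr h1,
    mvfderiv_fun_add (mdiffAt_inner hyz hw) (mdiffAt_inner hz hyw), add_apply,
    leviCivita_metric hx hyz hw, leviCivita_metric hx hz hyw]

theorem inner_curvature_skew (hX : CMDiffAt ∞ (T% X) x) (hY : CMDiffAt ∞ (T% Y) x)
    (hZ : CMDiffAt ∞ (T% Z) x) (hW : CMDiffAt ∞ (T% W) x) :
    ⟪curvature X Y Z x, W x⟫_ℝ = -⟪curvature X Y W x, Z x⟫_ℝ := by
  have h := mvfderiv_mlieBracket hX hY (contMDiffAt_inner hZ hW)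
  rw [mvfderiv_mvfderiv_inner hX hY hZ hW, mvfderiv_mvfderiv_inner hY hX hZ hW,
    leviCivita_metric (mdiffAt_of_contMDiffAt (contMDiffAt_mlieBracket hX hY))
      (mdiffAt_of_contMDiffAt hZ) (mdiffAt_of_contMDiffAt hW)] at h
  simp only [curvature, inner_sub_left]
  simp only [real_inner_comm (Z x)] at h ⊢
  linarith

theorem curvature_bianchi (hX : CMDiffAt ∞ (T% X) x) (hY : CMDiffAt ∞ (T% Y) x)
    (hZ : CMDiffAt ∞ (T% Z) x) :
    curvature X Y Z x + curvature Y Z X x + curvature Z X Y x = 0 := by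
  -- `∇_X ∇_Y Z - ∇_X ∇_Z Y = ∇_X [Y, Z] = [X, [Y, Z]] + ∇_[Y, Z] X`
  have key {X Y Z : Π x : M, TangentSpace I x} (hX : CMDiffAt ∞ (T% X) x)
      (hY : CMDiffAt ∞ (T% Y) x) (hZ : CMDiffAt ∞ (T% Z) x) :
      leviCivita I M (fun y => leviCivita I M Z y (Y y)) x (X x)
        - leviCivita I M (fun y => leviCivita I M Y y (Z y)) x (X x)
        = VectorField.mlieBracket I X (VectorField.mlieBracket I Y Z) x
          + leviCivita I M X x (VectorField.mlieBracket I Y Z x) := by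
    have hYZ := contMDiffAt_mlieBracket hY hZ
    have h1 := mdiffAt_of_contMDiffAt (contMDiffAt_leviCivita hY hZ)
    have h2 := mdiffAt_of_contMDiffAt (contMDiffAt_leviCivita hZ hY)
    rw [← leviCivita_sub_eq_mlieBracket (mdiffAt_of_contMDiffAt hX) (mdiffAt_of_contMDiffAt hYZ),
      sub_add_cancel, ← sub_apply, ← leviCivita_sub h1 h2,
      leviCivita_congr (mdifferentiableAt_sub_section h1 h2) (mdiffAt_of_contMDiffAt hYZ)]
    filter_upwards [eventually_mdiffAt hY, eventually_mdiffAt hZ] with y hy hz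
    exact leviCivita_sub_eq_mlieBracket hy hz
  have h1 := key hX hY hZ
  have h2 := key hY hZ hX
  have h3 := key hZ hX hY
  have h4 := jacobi_mlieBracket hX hY hZ
  rw [VectorField.mlieBracket_swap_apply (W := Z)
    (V := VectorField.mlieBracket I X Y), VectorField.mlieBracket_swap (V := X) (W := Z)] at h4
  have h5 : VectorField.mlieBracket I Y (-VectorField.mlieBracket I Z X) x =
      -VectorField.mlieBracket I Y (VectorField.mlieBracket I Z X) x := by
    have := VectorField.mlieBracket_const_smul_right (I := I) (V := Y) (c := (-1 : ℝ))
      (mdiffAt_of_contMDiffAt (contMDiffAt_mlieBracket hZ hX))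
    simpa using this
  rw [h5] at h4
  simp only [curvature]
  linear_combination (norm := module) h1 + h2 + h3 + h4

end Smooth

/-- The curvature tensor at `x`, on vectors extended to smooth vector fields near `x`. -/
noncomputable def curvatureAt (x : M) (u v w : TangentSpace I x) : TangentSpace I x :=
  curvature (FiberBundle.extend E u) (FiberBundle.extend E v) (FiberBundle.extend E w) x

theorem contMDiffAt_extend {x : M} (v : TangentSpace I x) :
    CMDiffAt ∞ (T% (FiberBundle.extend E v)) x :=
  FiberBundle.contMDiffAt_extend I E v

/-- By skew-symmetry, `R(X, Y)Z` at `x` depends on `Z` only through `Z x`. -/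
theorem curvature_extend [Nontrivial E] {x : M} (u v : TangentSpace I x)
    {Z : Π x : M, TangentSpace I x} (hZ : CMDiffAt ∞ (T% Z) x) :
    curvature (FiberBundle.extend E u) (FiberBundle.extend E v) Z x = curvatureAt x u v (Z x) := by
  refine ext_inner_right ℝ fun w => ?_
  have h1 := inner_curvature_skew (contMDiffAt_extend u) (contMDiffAt_extend v) hZ
    (contMDiffAt_extend w)
  have h2 := inner_curvature_skew (contMDiffAt_extend u) (contMDiffAt_extend v)
    (contMDiffAt_extend (Z x)) (contMDiffAt_extend w)
  simp only [FiberBundle.extend_apply_self] at h1 h2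
  rw [h1, curvatureAt, h2]

theorem isCurvatureLike_curvatureAt [Nontrivial E] (x : M) :
    IsCurvatureLike (curvatureAt (I := I) x) where
  swap _ _ _ := curvature_swap ..
  skew u v w z := by
    simpa [curvatureAt] using inner_curvature_skew (contMDiffAt_extend u) (contMDiffAt_extend v)
      (contMDiffAt_extend z) (contMDiffAt_extend w)
  bianchi u v w :=
    curvature_bianchi (contMDiffAt_extend u) (contMDiffAt_extend v) (contMDiffAt_extend w)

/-! ### Curvature of Kenmotsu manifolds -/

section Kenmotsu

variable {φ : Π x : M, TangentSpace I x →L[ℝ] TangentSpace I x}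
  {η : Π x : M, TangentSpace I x →L[ℝ] ℝ} {ξ : Π x : M, TangentSpace I x} {x : M}

theorem IsAlmostContactMetric.inner_phi_left (h : IsAlmostContactMetric φ η ξ)
    (u v : TangentSpace I x) : ⟪φ x u, v⟫_ℝ = -⟪u, φ x v⟫_ℝ := by
  have h1 := h.inner_phi_phi x u (φ x v)
  have h2 : ⟪φ x u, ξ x⟫_ℝ = 0 := by
    rw [real_inner_comm, ← h.eta_eq, h.eta_phi]
  rw [h.phi_phi, h.eta_phi, inner_add_right, inner_neg_right, inner_smul_right, h2] at h1
  linarith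

theorem IsAlmostContactMetric.contMDiffAt_phi_apply (h : IsAlmostContactMetric φ η ξ)
    {Y : Π x : M, TangentSpace I x} (hY : CMDiffAt ∞ (T% Y) x) :
    CMDiffAt ∞ (T% (fun y => φ y (Y y))) x :=
  ContMDiffAt.clm_bundle_apply (h.contMDiff_phi x) hY

theorem IsAlmostContactMetric.mdiffAt_phi_apply (h : IsAlmostContactMetric φ η ξ)
    {Y : Π x : M, TangentSpace I x} (hY : MDiffAt (T% Y) x) :
    MDiffAt (T% (fun y => φ y (Y y))) x :=
  MDifferentiableAt.clm_bundle_apply ((h.contMDiff_phi x).mdifferentiableAt (by simp)) hY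

theorem IsKenmotsu.leviCivita_phi (h : IsKenmotsu φ η ξ) {Y : Π x : M, TangentSpace I x}
    (hY : MDiffAt (T% Y) x) (v : TangentSpace I x) :
    leviCivita I M (fun y => φ y (Y y)) x v =
      φ x (leviCivita I M Y x v) + ⟪φ x v, Y x⟫_ℝ • ξ x - ⟪ξ x, Y x⟫_ℝ • φ x v := by
  have h1 := h.covDerivEnd_eq _ Y x (mdiffAt_of_contMDiffAt (contMDiffAt_extend v)) hY
  simp only [FiberBundle.extend_apply_self, covDerivEnd, h.eta_eq] at h1
  rw [add_sub_assoc, ← h1]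
  abel

/-- `∇_v ξ = v - η(v) ξ`: apply the defining equation to `Y = ξ` and use `φ ξ = 0`. -/
theorem IsKenmotsu.leviCivita_xi (h : IsKenmotsu φ η ξ) (v : TangentSpace I x) :
    leviCivita I M ξ x v = v - ⟪ξ x, v⟫_ℝ • ξ x := by
  have hξ := mdiffAt_of_contMDiffAt (h.contMDiff_xi x)
  have h0 : (fun y => φ y (ξ y)) = 0 := funext fun y => h.phi_xi y
  have hnorm (y : M) : ⟪ξ y, ξ y⟫_ℝ = 1 := by rw [← h.eta_eq, h.eta_xi]
  have h1 := h.leviCivita_phi hξ v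
  have h2 : ⟪φ x v, ξ x⟫_ℝ = 0 := by rw [real_inner_comm, ← h.eta_eq, h.eta_phi]
  rw [h0, CovariantDerivative.zero, h2, hnorm] at h1
  have h3 : ⟪ξ x, leviCivita I M ξ x v⟫_ℝ = 0 := by
    have h4 := leviCivita_metric (mdiffAt_of_contMDiffAt (contMDiffAt_extend v)) hξ hξ
    simp only [hnorm, FiberBundle.extend_apply_self, mvfderiv_const] at h4
    rw [real_inner_comm (ξ x)] at h4
    simp only [zero_apply] at h4
    linarith
  have h5 : φ x (leviCivita I M ξ x v) = φ x v := by
    simp only [Pi.zero_apply, zero_apply] at h1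
    linear_combination (norm := module) -h1
  have h6 := congr(φ x $h5)
  rw [h.phi_phi, h.phi_phi, h.eta_eq, h.eta_eq, h3] at h6
  linear_combination (norm := module) -h6

variable {X Y Z : Π x : M, TangentSpace I x}

/-- Second covariant derivative of `φ Z`. -/
theorem IsKenmotsu.leviCivita_leviCivita_phi [Nontrivial E] (h : IsKenmotsu φ η ξ)
    (hX : CMDiffAt ∞ (T% X) x) (hY : CMDiffAt ∞ (T% Y) x) (hZ : CMDiffAt ∞ (T% Z) x) :
    leviCivita I M (fun y => leviCivita I M (fun z => φ z (Z z)) y (Y y)) x (X x) =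
      φ x (leviCivita I M (fun y => leviCivita I M Z y (Y y)) x (X x))
        + ⟪φ x (X x), leviCivita I M Z x (Y x)⟫_ℝ • ξ x
        - ⟪ξ x, leviCivita I M Z x (Y x)⟫_ℝ • φ x (X x)
        + ⟪φ x (Y x), Z x⟫_ℝ • (X x - ⟪ξ x, X x⟫_ℝ • ξ x)
        + (⟪φ x (leviCivita I M Y x (X x)) + ⟪φ x (X x), Y x⟫_ℝ • ξ x
            - ⟪ξ x, Y x⟫_ℝ • φ x (X x), Z x⟫_ℝ
          + ⟪φ x (Y x), leviCivita I M Z x (X x)⟫_ℝ) • ξ x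
        - ⟪ξ x, Z x⟫_ℝ • (φ x (leviCivita I M Y x (X x)) + ⟪φ x (X x), Y x⟫_ℝ • ξ x
            - ⟪ξ x, Y x⟫_ℝ • φ x (X x))
        - (⟪X x - ⟪ξ x, X x⟫_ℝ • ξ x, Z x⟫_ℝ + ⟪ξ x, leviCivita I M Z x (X x)⟫_ℝ)
            • φ x (Y x) := by
  let φY : Π x : M, TangentSpace I x := fun y => φ y (Y y)
  let D : Π x : M, TangentSpace I x := fun y => leviCivita I M Z y (Y y)
  let φD : Π x : M, TangentSpace I x := fun y => φ y (D y)
  let f : M → ℝ := fun y => ⟪φY y, Z y⟫_ℝ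
  let g : M → ℝ := fun y => ⟪ξ y, Z y⟫_ℝ
  have hD' : CMDiffAt ∞ (T% D) x := contMDiffAt_leviCivita hY hZ
  have hL : MDiffAt (T% (fun y => leviCivita I M (fun z => φ z (Z z)) y (Y y))) x :=
    mdiffAt_of_contMDiffAt (contMDiffAt_leviCivita hY (h.contMDiffAt_phi_apply hZ))
  have hx := mdiffAt_of_contMDiffAt hX
  have hz := mdiffAt_of_contMDiffAt hZ
  have hy := mdiffAt_of_contMDiffAt hY
  have hξ := mdiffAt_of_contMDiffAt (h.contMDiff_xi x)
  have hφY : MDiffAt (T% φY) x := h.mdiffAt_phi_apply hy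
  have hD : MDiffAt (T% D) x := mdiffAt_of_contMDiffAt hD'
  have hφD : MDiffAt (T% φD) x := h.mdiffAt_phi_apply hD
  have hf : MDiffAt f x := mdiffAt_inner hφY hz
  have hg : MDiffAt g x := mdiffAt_inner hξ hz
  have hfξ : MDiffAt (T% (f • ξ)) x := hf.smul_section hξ
  have hgφ : MDiffAt (T% (g • φY)) x := hg.smul_section hφY
  have hsum : MDiffAt (T% (φD + f • ξ)) x := mdifferentiableAt_add_section hφD hfξ
  have hEq : ∀ᶠ y in nhds x, leviCivita I M (fun z => φ z (Z z)) y (Y y) =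
      (φD + f • ξ - g • φY) y := by
    filter_upwards [eventually_mdiffAt hZ] with y hzy
    exact h.leviCivita_phi hzy (Y y)
  rw [leviCivita_congr hL (mdifferentiableAt_sub_section hsum hgφ) hEq, leviCivita_sub hsum hgφ,
    leviCivita_add hφD hfξ, sub_apply, add_apply, leviCivita_smul hξ hf, leviCivita_smul hφY hg,
    h.leviCivita_xi, leviCivita_metric hx hφY hz, leviCivita_metric hx hξ hz,
    h.leviCivita_phi hy, h.leviCivita_phi hD, h.leviCivita_xi]
  simp only [φY, D, f, g]
  module

/-- On a Kenmotsu manifold `φ` commutes with the difference of the curvature tensor and the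
curvature tensor of constant curvature `-1`. -/
theorem IsKenmotsu.curvature_phi [Nontrivial E] (h : IsKenmotsu φ η ξ)
    (hX : CMDiffAt ∞ (T% X) x) (hY : CMDiffAt ∞ (T% Y) x) (hZ : CMDiffAt ∞ (T% Z) x) :
    curvature X Y (fun y => φ y (Z y)) x
        + (⟪Y x, φ x (Z x)⟫_ℝ • X x - ⟪X x, φ x (Z x)⟫_ℝ • Y x) =
      φ x (curvature X Y Z x + (⟪Y x, Z x⟫_ℝ • X x - ⟪X x, Z x⟫_ℝ • Y x)) := by
  have h1 (u : TangentSpace I x) : ⟪u, φ x (Z x)⟫_ℝ = -⟪φ x u, Z x⟫_ℝ := by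
    rw [h.inner_phi_left, neg_neg]
  rw [h1, h1, curvature, curvature, h.leviCivita_leviCivita_phi hX hY hZ,
    h.leviCivita_leviCivita_phi hY hX hZ, h.leviCivita_phi (mdiffAt_of_contMDiffAt hZ),
    ← leviCivita_sub_eq_mlieBracket (mdiffAt_of_contMDiffAt hX) (mdiffAt_of_contMDiffAt hY)]
  simp only [map_add, map_sub, map_smul, inner_add_left, inner_sub_left, inner_smul_left,
    RCLike.conj_to_real]
  module

theorem IsKenmotsu.curvatureAt_phi [Nontrivial E] (h : IsKenmotsu φ η ξ)
    (u v w : TangentSpace I x) :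
    curvatureAt x u v (φ x w) + (⟪v, φ x w⟫_ℝ • u - ⟪u, φ x w⟫_ℝ • v) =
      φ x (curvatureAt x u v w + (⟪v, w⟫_ℝ • u - ⟪u, w⟫_ℝ • v)) := by
  have h1 := h.curvature_phi (contMDiffAt_extend u) (contMDiffAt_extend v) (contMDiffAt_extend w)
  rw [curvature_extend u v (h.contMDiffAt_phi_apply (contMDiffAt_extend w))] at h1
  simpa [curvatureAt] using h1

/-- As `φ ξ = 0`, the endomorphism `φ` annihilates the left-hand side, which is therefore a
multiple of `ξ`; by skew-symmetry of the curvature it is also orthogonal to `ξ`. -/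
theorem IsKenmotsu.curvatureAt_xi [Nontrivial E] (h : IsKenmotsu φ η ξ)
    (u v : TangentSpace I x) :
    curvatureAt x u v (ξ x) + (⟪v, ξ x⟫_ℝ • u - ⟪u, ξ x⟫_ℝ • v) = 0 := by
  have hR := (isCurvatureLike_curvatureAt (I := I) x).add_constCurv
  have h1 := hR.skew u v (ξ x) (ξ x)
  have h2 := h.curvatureAt_phi u v (ξ x)
  have h0 := (hR.isLinearMap_right u v).map_zero
  rw [h.phi_xi, h0] at h2
  have h4 : ⟪ξ x, curvatureAt x u v (ξ x) + (⟪v, ξ x⟫_ℝ • u - ⟪u, ξ x⟫_ℝ • v)⟫_ℝ = 0 := by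
    rw [real_inner_comm (curvatureAt x u v (ξ x) + (⟪v, ξ x⟫_ℝ • u - ⟪u, ξ x⟫_ℝ • v))]
    linarith
  have h3 := congr(φ x $h2)
  rw [map_zero, h.phi_phi, h.eta_eq, h4, zero_smul, add_zero] at h3
  exact neg_eq_zero.1 h3.symm

end Kenmotsu

/-! ### Three-Kenmotsu manifolds are Einstein -/

/-- The Einstein constant of a 3-Kenmotsu manifold is `-(dim M - 1)`. -/
theorem IsThreeKenmotsu.ricci_eq [Nontrivial E]
    {φ : Fin 3 → Π x : M, TangentSpace I x →L[ℝ] TangentSpace I x}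
    {η : Π x : M, TangentSpace I x →L[ℝ] ℝ} {ξ : Π x : M, TangentSpace I x}
    (h : IsThreeKenmotsu φ η ξ) (x : M) (v w : TangentSpace I x) :
    ricci x v w = -((Module.finrank ℝ E : ℝ) - 1) * ⟪v, w⟫_ℝ := by
  have : FiniteDimensional ℝ (TangentSpace I x) := inferInstanceAs (FiniteDimensional ℝ E)
  have hR := isCurvatureLike_curvatureAt (I := I) x
  have hK := h.isKenmotsu
  have h01 (u : TangentSpace I x) : φ 2 x u = φ 0 x (φ 1 x u) := h.phi_comp 0 x u
  have h10 (u : TangentSpace I x) : φ 1 x (φ 0 x u) = -φ 2 x u := by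
    have h1 : φ 1 x (φ 0 x u) = φ 2 x (φ 0 x (φ 0 x u)) := h.phi_comp 2 x _
    rw [h1, (hK 0).phi_phi, map_add, map_neg, map_smul, (hK 2).phi_xi, smul_zero, add_zero]
  have htr := hR.add_constCurv.trace_ricciOperator_eq_zero (A := (φ 0 x).toLinearMap)
    (B := (φ 1 x).toLinearMap) (C := (φ 2 x).toLinearMap) (ξ := ξ x) h01 h10
    (fun u => by simpa [(hK 2).eta_eq] using (hK 2).phi_phi x u)
    (fun u v => (hK 2).inner_phi_left u v) (fun u v w => (hK 0).curvatureAt_phi u v w)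
    (fun u v w => (hK 1).curvatureAt_phi u v w) (fun u v => (hK 0).curvatureAt_xi u v) v w
  have hsum := hR.sum_inner_eq (stdOrthonormalBasis ℝ (TangentSpace I x)) v w htr
  exact hsum

end Riem

theorem mainTheorem1 (m : ℕ) (hm : 9 ≤ m)
    {M : Type*} [TopologicalSpace M] [T2Space M] [SecondCountableTopology M]
    [ChartedSpace (EuclideanSpace ℝ (Fin m)) M] [IsManifold (𝓡 m) ∞ M]
    [RiemannianBundle (fun x : M => TangentSpace (𝓡 m) x)]
    [IsContMDiffRiemannianBundle (𝓡 m) ∞ (EuclideanSpace ℝ (Fin m))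
      (fun x : M => TangentSpace (𝓡 m) x)]
    (φ : Fin 3 → Π x : M, TangentSpace (𝓡 m) x →L[ℝ] TangentSpace (𝓡 m) x)
    (η : Π x : M, TangentSpace (𝓡 m) x →L[ℝ] ℝ)
    (ξ : Π x : M, TangentSpace (𝓡 m) x)
    (hM : Riem.IsThreeKenmotsu φ η ξ) :
    Riem.IsEinstein (𝓡 m) M := by
  have : Nonempty (Fin m) := ⟨⟨0, by omega⟩⟩
  exact ⟨_, hM.ricci_eq⟩
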